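/- **Conventions.** Let $k\ge 0$. A $k$-graph is a countable category $\Lambda$ with a functor $d:\Lambda\to\mathbb N^k$ such that whenever $d(\lambda)=m+n$ there are unique $\mu,\nu\in\Lambda$ with $\lambda=\mu\nu$, $d(\mu)=m$, $d(\nu)=n$. An arrow $\lambda$ has range $r(\lambda)$ and source $s(\lambda)$, and $\mu\nu$ is defined when $s(\mu)=r(\nu)$. $\Lambda$ is row-finite and source-free if $\{\lambda: r(\lambda)=v,\ d(\lambda)=m\}$ is finite and nonempty for all objects $v$ and $m\in\mathbb N^k$. An infinite path is a degree-preserving functor $x:\Omega_k\to\Lambda$, where $\Omega_k$ has objects $\mathbb N^k$ and one arrow $(p,q)$, with range $p$, source $q$ and degree $q-p$, for each $p\le q$. The set $\Lambda^\infty$ of infinite paths has the topology generated by the sets $Z(\lambda)=\{x: x(0,d(\lambda))=\lambda\}$. Put $\sigma^p(x)(m,n)=x(m+p,n+p)$. The path groupoid is $$\mathcal G_\Lambda=\{(x,n,y)\in\Lambda^\infty\times\mathbb Z^k\times\Lambda^\infty:\ \exists\, j,\ell\in\mathbb N^k,\ n=j-\ell,\ \sigma^j(x)=\sigma^\ell(y)\},$$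 with $r(x,n,y)=x$, $s(x,n,y)=y$, $(x,n,y)(y,m,z)=(x,n+m,z)$, unit space $\Lambda^\infty$, and the topology generated by the sets $$Z(\lambda,\mu)=\{(x,d(\lambda)-d(\mu),y): x\in Z(\lambda),\ y\in Z(\mu),\ \sigma^{d(\lambda)}(x)=\sigma^{d(\mu)}(y)\},\qquad s(\lambda)=s(\mu).$$ A right $\Lambda$-module is a contravariant functor $\mathcal A$ from $\Lambda$ to abelian groups, with groups $\mathcal A_v$ and maps $\mathcal A(\lambda):\mathcal A_{r(\lambda)}\to\mathcal A_{s(\lambda)}$; morphisms are natural transformations, and a sequence $\mathcal A\to\mathcal B\to\mathcal C$ is exact if $\mathcal A_v\to\mathcal B_v\to\mathcal C_v$ is exact for every object $v$. A $\mathcal G_\Lambda$-sheaf is a topological space $\mathscr A$ with a local homeomorphism $\pi:\mathscr A\to\Lambda^\infty$ whose fibres $\mathscr A(x)=\pi^{-1}(x)$ are abelian groups with continuous fibrewise operations, together with isomorphisms $\alpha_\gamma:\mathscr A(s(\gamma))\to\mathscr A(r(\gamma))$, $\gamma\in\mathcal G_\Lambda$, such that $\alpha_x=\mathrm{id}$ for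 units $x$, $\alpha_{\gamma_1}\alpha_{\gamma_2}=\alpha_{\gamma_1\gamma_2}$ for composable $\gamma_1,\gamma_2$, and $(\gamma,a)\mapsto\alpha_\gamma(a)$ is continuous on $\{(\gamma,a): s(\gamma)=\pi(a)\}$. Morphisms are continuous fibre-preserving equivariant maps that are homomorphisms on fibres; they are added fibrewise. **Theorem.** Let $\Lambda$ be a row-finite source-free $k$-graph. For a right $\Lambda$-module $\mathcal A$ and $x\in\Lambda^\infty$ let $\underline{\mathcal A}(x)=\varinjlim_{p\in\mathbb N^k}\mathcal A_{x(p)}$, along the maps $\mathcal A(x(p,q))$ for $p\le q$, with canonical maps $\varphi^x_p:\mathcal A_{x(p)}\to\underline{\mathcal A}(x)$. Equip $\underline{\mathcal A}=\bigsqcup_{x\in\Lambda^\infty}\underline{\mathcal A}(x)$ with the topology generated by the sets $S_{a,\lambda}=\{\varphi^y_q(a): y(0,q)=\lambda\}$, for $\lambda\in\Lambda$, $a\in\mathcal A_{s(\lambda)}$. 1. $\underline{\mathcal A}$, with the projection to $\Lambda^\infty$ and an action $\alpha$ of $\mathcal G_\Lambda$ such that $\alpha_{(x,n,y)}(\varphi^y_q(b))=\varphi^x_p(b)$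 whenever $n=p-q$, $\sigma^p(x)=\sigma^q(y)$ and $b\in\mathcal A_{y(q)}=\mathcal A_{x(p)}$, is a $\mathcal G_\Lambda$-sheaf. 2. For every morphism $\eta:\mathcal A\to\mathcal B$ of $\Lambda$-modules there is a morphism $\underline\eta:\underline{\mathcal A}\to\underline{\mathcal B}$ of $\mathcal G_\Lambda$-sheaves with $\underline\eta(\varphi^x_p(a))=\varphi^x_p(\eta(a))$ for all $x$, $p$ and $a\in\mathcal A_{x(p)}$. On the stalks at $x$ it is the direct limit of the maps $\eta\circ\mathcal A(x(p,q))$, and also the direct limit of the maps $\mathcal B(x(p,q))\circ\eta$, from $\mathcal A_{x(p)}$ to $\mathcal B_{x(q)}$, $p\le q$. 3. $\mathcal A\mapsto\underline{\mathcal A}$, $\eta\mapsto\underline\eta$ is a functor from right $\Lambda$-modules to $\mathcal G_\Lambda$-sheaves; the maps $\operatorname{Hom}_\Lambda(\mathcal A,\mathcal B)\to\operatorname{Hom}_{\mathcal G_\Lambda}(\underline{\mathcal A},\underline{\mathcal B})$ are group homomorphisms; and the functor is exact: if $\mathcal A\to\mathcal B\to\mathcal C$ is an exact sequence of $\Lambda$-modules,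 then $\underline{\mathcal A}\to\underline{\mathcal B}\to\underline{\mathcal C}$ is exact in the category of $\mathcal G_\Lambda$-sheaves, and exact on the stalk at every $x\in\Lambda^\infty$. -/

import Mathlib

open CategoryTheory
open scoped Topology

universe u v w

/-! ### Higher-rank graphs

Throughout, an arrow `f : X ⟶ Y` has source `s(f) = X` and range `r(f) = Y`, so the composite
`λ μ` of arrows with `s(λ) = r(μ)` is `μ ≫ λ`. -/

/-- A `k`-graph structure on a category `Λ`: the category is countable, and there is a degree
functor to `ℕ^k` with the unique factorization property: if `d(f) = m + n`, there are unique
`μ`, `ν` with `f = μ ν`, `d(μ) = m`, `d(ν) = n`. -/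
class KGraph (k : ℕ) (Λ : Type u) [Category.{v} Λ] where
  countable_obj : Countable Λ
  countable_hom : ∀ X Y : Λ, Countable (X ⟶ Y)
  degree : ∀ {X Y : Λ}, (X ⟶ Y) → (Fin k → ℕ)
  degree_id : ∀ X : Λ, degree (𝟙 X) = 0
  degree_comp : ∀ {X Y Z : Λ} (ν : X ⟶ Y) (μ : Y ⟶ Z), degree (ν ≫ μ) = degree μ + degree ν
  factorization : ∀ {X Y : Λ} (f : X ⟶ Y) (m n : Fin k → ℕ), degree f = m + n →
    ∃! t : (Σ Z : Λ, (Z ⟶ Y) × (X ⟶ Z)),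
      t.2.2 ≫ t.2.1 = f ∧ degree t.2.1 = m ∧ degree t.2.2 = n

namespace KGraph

variable (k : ℕ) (Λ : Type u) [Category.{v} Λ] [KGraph k Λ]

variable {Λ} in
/-- `v Λ^m`: the arrows with range `v` and degree `m`. -/
def arrowsTo (v : Λ) (m : Fin k → ℕ) : Set (Σ X : Λ, (X ⟶ v)) :=
  {f | degree f.2 = m}

/-- `Λ` is row-finite: every `v Λ^m` is finite. -/
def RowFinite : Prop := ∀ (v : Λ) (m : Fin k → ℕ), (arrowsTo k v m).Finite

/-- `Λ` has no sources: every `v Λ^m` is nonempty. -/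
def NoSources : Prop := ∀ (v : Λ) (m : Fin k → ℕ), (arrowsTo k v m).Nonempty

end KGraph

/-! ### The infinite path space -/

/-- An infinite path: a degree-preserving functor `Ω_k → Λ`. The category `Ω_k` has object set
`ℕ^k` and one arrow `(m, n)`, with range `m`, source `n` and degree `n - m`, for each `m ≤ n`;
here `x.obj m = x(m)` and `x.map h = x(m, n)` for `h : m ≤ n`. -/
structure InfinitePath (k : ℕ) (Λ : Type u) [Category.{v} Λ] [KGraph k Λ] where
  obj : (Fin k → ℕ) → Λ
  map : ∀ {m n : Fin k → ℕ}, m ≤ n → (obj n ⟶ obj m)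
  map_refl : ∀ m : Fin k → ℕ, map (le_refl m) = 𝟙 (obj m)
  map_trans : ∀ {m n p : Fin k → ℕ} (h : m ≤ n) (h' : n ≤ p),
    map (h.trans h') = map h' ≫ map h
  degree_map : ∀ {m n : Fin k → ℕ} (h : m ≤ n), KGraph.degree (k := k) (map h) = n - m

namespace InfinitePath

variable {k : ℕ} {Λ : Type u} [Category.{v} Λ] [KGraph k Λ]

/-- The initial segment `x(0, p)`, as an element of the set of all arrows of `Λ`. -/
def initial (x : InfinitePath k Λ) (p : Fin k → ℕ) : Arrow Λ :=
  Arrow.mk (x.map (show 0 ≤ p from zero_le))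

/-- The shift `σ^p(x)(m, n) = x(m + p, n + p)`. -/
def shift (p : Fin k → ℕ) (x : InfinitePath k Λ) : InfinitePath k Λ where
  obj m := x.obj (m + p)
  map h := x.map (add_le_add_left h p)
  map_refl m := x.map_refl (m + p)
  map_trans h h' := x.map_trans (add_le_add_left h p) (add_le_add_left h' p)
  degree_map h := by rw [x.degree_map, add_tsub_add_eq_tsub_right]

theorem ext_path {x y : InfinitePath k Λ} (hobj : ∀ m, x.obj m = y.obj m)
    (hmap : ∀ {m n : Fin k → ℕ} (h : m ≤ n), HEq (x.map h) (y.map h)) : x = y := by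
  obtain ⟨xo, xm, _, _, _⟩ := x
  obtain ⟨yo, ym, _, _, _⟩ := y
  obtain rfl : xo = yo := funext hobj
  have : @xm = @ym := by
    funext m n h
    exact eq_of_heq (hmap h)
  subst this
  rfl

theorem map_heq (x : InfinitePath k Λ) {m n m' n' : Fin k → ℕ} (hm : m = m') (hn : n = n')
    (h : m ≤ n) (h' : m' ≤ n') : HEq (x.map h) (x.map h') := by
  subst hm; subst hn; rfl

theorem shift_shift (p q : Fin k → ℕ) (x : InfinitePath k Λ) :
    shift q (shift p x) = shift (p + q) x :=
  ext_path (fun m => congrArg x.obj (by abel))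
    (fun _ => x.map_heq (by abel) (by abel) _ _)

/-- The cylinder set `Z(λ) = {x : x(0, d(λ)) = λ}`. -/
def cylinder (l : Arrow Λ) : Set (InfinitePath k Λ) :=
  {x | x.initial (KGraph.degree l.hom) = l}

/-- The topology on `Λ^∞` generated by the cylinder sets. -/
instance : TopologicalSpace (InfinitePath k Λ) :=
  TopologicalSpace.generateFrom (Set.range cylinder)

/-! ### The path groupoid -/

/-- The elements `(x, n, y)` of the path groupoid `𝒢_Λ`, which have source `y` and range `x`:
`n` is of the form `j - l` with `σ^j(x) = σ^l(y)`. -/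
@[ext]
structure GroupoidHom (y x : InfinitePath k Λ) where
  lag : Fin k → ℤ
  exists_shift : ∃ j l : Fin k → ℕ, (∀ i, (j i : ℤ) - (l i : ℤ) = lag i) ∧ shift j x = shift l y

/-- The path groupoid `𝒢_Λ`, with unit space `Λ^∞` (where `x` is identified with `(x, 0, x)`)
and composition `(x, n, y) (y, m, z) = (x, n + m, z)`. -/
instance : Groupoid (InfinitePath k Λ) where
  Hom y x := GroupoidHom y x
  id x := ⟨0, 0, 0, by simp, rfl⟩
  comp {z y x} f g := ⟨g.lag + f.lag, by
    obtain ⟨j, l, h, e⟩ := g.exists_shift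
    obtain ⟨j', l', h', e'⟩ := f.exists_shift
    refine ⟨j + j', l' + l, fun i => ?_, ?_⟩
    · simp only [Pi.add_apply, Nat.cast_add, ← h, ← h']; ring
    · rw [← shift_shift, e, shift_shift, add_comm l j', ← shift_shift, e', shift_shift]⟩
  id_comp f := GroupoidHom.ext (add_zero _)
  comp_id f := GroupoidHom.ext (zero_add _)
  assoc f g h := GroupoidHom.ext (add_assoc _ _ _).symm
  inv f := ⟨-f.lag, by
    obtain ⟨j, l, h, e⟩ := f.exists_shift
    exact ⟨l, j, fun i => by simp [← h], e.symm⟩⟩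
  inv_comp f := GroupoidHom.ext (add_neg_cancel _)
  comp_inv f := GroupoidHom.ext (neg_add_cancel _)

/-- The degree `n` of the groupoid element `(x, n, y)`. -/
def lag {y x : InfinitePath k Λ} (γ : y ⟶ x) : Fin k → ℤ := GroupoidHom.lag γ

/-- The sets `Z(λ, μ) = {(λ z, d(λ) - d(μ), μ z) : z ∈ Λ^∞, z(0) = s(λ) = s(μ)}`: a groupoid
element `(x, n, y)` belongs to `Z(λ, μ)` iff `x ∈ Z(λ)`, `y ∈ Z(μ)`, `n = d(λ) - d(μ)` and
`σ^{d(λ)}(x) = σ^{d(μ)}(y)`. -/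
def groupoidCylinder (l m : Arrow Λ) : Set (Arrow (InfinitePath k Λ)) :=
  {γ | γ.right ∈ cylinder (k := k) l ∧ γ.left ∈ cylinder (k := k) m ∧
    (∀ i, lag γ.hom i = (KGraph.degree (k := k) l.hom i : ℤ) - KGraph.degree (k := k) m.hom i) ∧
    shift (KGraph.degree l.hom) γ.right = shift (KGraph.degree m.hom) γ.left}

/-- The topology on (the set of arrows of) `𝒢_Λ` generated by the sets `Z(λ, μ)` with
`s(λ) = s(μ)`. -/
instance : TopologicalSpace (Arrow (InfinitePath k Λ)) :=
  TopologicalSpace.generateFrom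
    {U | ∃ l m : Arrow Λ, l.left = m.left ∧ U = groupoidCylinder l m}

end InfinitePath

/-! ### Sheaves over a groupoid -/

/-- The disjoint union of a family of stalks. -/
structure EtaleSpace {X : Type u} (E : X → Type w) where
  base : X
  elt : E base

/-- The data and conditions which make the disjoint union of a family of abelian groups `E x`,
`x ∈ X`, equipped with a topology, into a `𝒢`-sheaf, where `𝒢` is a groupoid with unit space `X` and topologies on
`X` and on the set of arrows `Arrow X`. -/
structure GroupoidSheafStructure {X : Type u} [TopologicalSpace X] [Groupoid.{v} X]
    [TopologicalSpace (Arrow X)] (E : X → Type w) [∀ x, AddCommGroup (E x)]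
    [TopologicalSpace (EtaleSpace E)] where
  isLocalHomeomorph_base : IsLocalHomeomorph (EtaleSpace.base : EtaleSpace E → X)
  /-- Addition is continuous on the fibre product of the total space with itself over `X`. -/
  continuous_add :
    Continuous[TopologicalSpace.induced
      (fun t : (Σ x, E x × E x) =>
        ((⟨t.1, t.2.1⟩, ⟨t.1, t.2.2⟩) : EtaleSpace E × EtaleSpace E)) inferInstance,
      inferInstance] (fun t => (⟨t.1, t.2.1 + t.2.2⟩ : EtaleSpace E))
  continuous_neg : Continuous (fun t : EtaleSpace E => (⟨t.base, -t.elt⟩ : EtaleSpace E))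
  /-- The isomorphism `α_γ` from the stalk at `s(γ) = y` to the stalk at `r(γ) = x`. -/
  act : ∀ {y x : X}, (y ⟶ x) → (E y ≃+ E x)
  act_id : ∀ (x : X) (a : E x), act (𝟙 x) a = a
  act_comp : ∀ {z y x : X} (γ' : z ⟶ y) (γ : y ⟶ x) (a : E z),
    act (γ' ≫ γ) a = act γ (act γ' a)
  /-- The action is continuous on `𝒢 * E = {(γ, a) : s(γ) = π(a)}`, which has the topology induced
  from `𝒢 × E`. -/
  continuous_act :
    Continuous[TopologicalSpace.induced
      (fun t : (Σ γ : Arrow X, E γ.left) =>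
        ((t.1, ⟨t.1.left, t.2⟩) : Arrow X × EtaleSpace E)) inferInstance,
      inferInstance] (fun t => (⟨t.1.right, act t.1.hom t.2⟩ : EtaleSpace E))

/-- A `𝒢`-sheaf of abelian groups. -/
structure GroupoidSheaf (X : Type u) [TopologicalSpace X] [Groupoid.{v} X]
    [TopologicalSpace (Arrow X)] where
  stalk : X → Type w
  [addCommGroup : ∀ x, AddCommGroup (stalk x)]
  [topology : TopologicalSpace (EtaleSpace stalk)]
  str : GroupoidSheafStructure stalk

namespace GroupoidSheaf

attribute [instance] GroupoidSheaf.addCommGroup GroupoidSheaf.topology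

variable {X : Type u} [TopologicalSpace X] [Groupoid.{v} X] [TopologicalSpace (Arrow X)]

/-- A morphism of `𝒢`-sheaves: a family of homomorphisms of stalks which is equivariant and
continuous as a map of total spaces. -/
@[ext]
structure Hom (A B : GroupoidSheaf.{u, v, w} X) where
  app : ∀ x, A.stalk x →+ B.stalk x
  continuous_app : Continuous
    (fun t : EtaleSpace A.stalk => (⟨t.base, app t.base t.elt⟩ : EtaleSpace B.stalk))
  equivariant : ∀ {y x : X} (γ : y ⟶ x) (a : A.stalk y),
    app x (A.str.act γ a) = B.str.act γ (app y a)

instance : Category (GroupoidSheaf.{u, v, w} X) where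
  Hom A B := Hom A B
  id A := ⟨fun x => AddMonoidHom.id _, continuous_id, fun _ _ => rfl⟩
  comp f g := ⟨fun x => (g.app x).comp (f.app x), g.continuous_app.comp f.continuous_app,
    fun γ a => by simp [f.equivariant, g.equivariant]⟩

/-- The homomorphism of stalks at `x` given by a morphism of `𝒢`-sheaves. -/
def stalkMap {A B : GroupoidSheaf.{u, v, w} X} (f : A ⟶ B) (x : X) : A.stalk x →+ B.stalk x :=
  Hom.app f x

theorem continuous_add_comp (A : GroupoidSheaf.{u, v, w} X) {T : Type*} [TopologicalSpace T]
    (b : T → X) (f g : ∀ t, A.stalk (b t))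
    (hf : Continuous fun t => (⟨b t, f t⟩ : EtaleSpace A.stalk))
    (hg : Continuous fun t => (⟨b t, g t⟩ : EtaleSpace A.stalk)) :
    Continuous fun t => (⟨b t, f t + g t⟩ : EtaleSpace A.stalk) := by
  let : TopologicalSpace (Σ x, A.stalk x × A.stalk x) := TopologicalSpace.induced
      (fun t : (Σ x, A.stalk x × A.stalk x) =>
        ((⟨t.1, t.2.1⟩, ⟨t.1, t.2.2⟩) : EtaleSpace A.stalk × EtaleSpace A.stalk)) inferInstance
  have h : Continuous (fun t => (⟨b t, f t, g t⟩ : Σ x, A.stalk x × A.stalk x)) :=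
    continuous_induced_rng.2 (hf.prodMk hg)
  exact A.str.continuous_add.comp h

/-- The zero section is continuous. -/
theorem continuous_zero (A : GroupoidSheaf.{u, v, w} X) :
    Continuous fun x : X => (⟨x, 0⟩ : EtaleSpace A.stalk) := by
  rw [continuous_iff_continuousAt]
  intro x
  obtain ⟨e, hx, he⟩ := A.str.isLocalHomeomorph_base ⟨x, 0⟩
  have hbase : ∀ t : EtaleSpace A.stalk, e t = t.base := fun t => (congrFun he t).symm
  have hxt : x ∈ e.target := by
    have := e.map_source hx
    rwa [hbase] at this
  have hs : Continuous fun y : e.target => e.symm y.1 :=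
    continuousOn_iff_continuous_domRestrict.1 e.continuousOn_symm
  have hn := A.str.continuous_neg.comp hs
  have h0 := A.continuous_add_comp (fun y : e.target => (e.symm y.1).base)
    (fun y => (e.symm y.1).elt) (fun y => -(e.symm y.1).elt) hs hn
  have hb : ∀ y : e.target, (e.symm y.1).base = y.1 := fun y => by
    rw [← hbase, e.right_inv y.2]
  have h1 : Continuous fun y : e.target => (⟨y.1, 0⟩ : EtaleSpace A.stalk) := by
    refine h0.congr fun y => ?_
    have : ∀ {p q : X} (_ : p = q) (a : A.stalk p),
        (⟨p, a + -a⟩ : EtaleSpace A.stalk) = ⟨q, 0⟩ := by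
      rintro p _ rfl a
      rw [add_neg_cancel]
    exact this (hb y) _
  have h2 : ContinuousOn (fun y : X => (⟨y, 0⟩ : EtaleSpace A.stalk)) e.target :=
    continuousOn_iff_continuous_domRestrict.2 h1
  exact h2.continuousAt (e.open_target.mem_nhds hxt)

theorem continuous_base (A : GroupoidSheaf.{u, v, w} X) :
    Continuous (EtaleSpace.base : EtaleSpace A.stalk → X) :=
  A.str.isLocalHomeomorph_base.continuous

variable {A B : GroupoidSheaf.{u, v, w} X}

instance : Zero (A ⟶ B) :=
  ⟨⟨fun _ => 0, B.continuous_zero.comp A.continuous_base, fun γ a => by simp⟩⟩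

instance : Add (A ⟶ B) :=
  ⟨fun f g => ⟨fun x => stalkMap f x + stalkMap g x,
    B.continuous_add_comp (T := EtaleSpace A.stalk) EtaleSpace.base
      (fun t => stalkMap f t.base t.elt) (fun t => stalkMap g t.base t.elt)
      (Hom.continuous_app f) (Hom.continuous_app g),
    fun γ a => by
      simp only [AddMonoidHom.add_apply, map_add]
      exact congrArg₂ _ (Hom.equivariant f γ a) (Hom.equivariant g γ a)⟩⟩

instance : Neg (A ⟶ B) :=
  ⟨fun f => ⟨fun x => -stalkMap f x, B.str.continuous_neg.comp (Hom.continuous_app f),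
    fun γ a => by
      simp only [AddMonoidHom.neg_apply, map_neg]
      exact congrArg _ (Hom.equivariant f γ a)⟩⟩

theorem hom_ext {f g : A ⟶ B} (h : ∀ x, stalkMap f x = stalkMap g x) : f = g :=
  Hom.ext (funext h)

/-- Morphisms of `𝒢`-sheaves form an abelian group under stalkwise addition. -/
instance : AddCommGroup (A ⟶ B) where
  add_assoc f g h := hom_ext fun x => add_assoc (stalkMap f x) (stalkMap g x) (stalkMap h x)
  zero_add f := hom_ext fun x => zero_add (stalkMap f x)
  add_zero f := hom_ext fun x => add_zero (stalkMap f x)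
  add_comm f g := hom_ext fun x => add_comm (stalkMap f x) (stalkMap g x)
  neg_add_cancel f := hom_ext fun x => neg_add_cancel (stalkMap f x)
  nsmul := nsmulRec
  zsmul := zsmulRec

theorem stalkMap_add (f g : A ⟶ B) (x : X) :
    stalkMap (f + g) x = stalkMap f x + stalkMap g x := rfl

theorem stalkMap_comp {C : GroupoidSheaf.{u, v, w} X} (f : A ⟶ B) (g : B ⟶ C) (x : X) :
    stalkMap (f ≫ g) x = (stalkMap g x).comp (stalkMap f x) := rfl

instance : Preadditive (GroupoidSheaf.{u, v, w} X) where
  add_comp _ _ _ f f' g := hom_ext fun x => by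
    rw [stalkMap_comp, stalkMap_add, stalkMap_add, stalkMap_comp, stalkMap_comp,
      AddMonoidHom.comp_add]
  comp_add _ _ _ f g g' := hom_ext fun x => by
    rw [stalkMap_comp, stalkMap_add, stalkMap_add, stalkMap_comp, stalkMap_comp,
      AddMonoidHom.add_comp]

end GroupoidSheaf

/-! ### The sheaf associated to a module -/

noncomputable section

/-- Right `Λ`-modules: contravariant functors from `Λ` to abelian groups. Morphisms are natural
transformations. -/
abbrev RightModule (Λ : Type u) [Category.{v} Λ] := Λᵒᵖ ⥤ AddCommGrpCat.{w}

namespace RightModule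

variable {Λ : Type u} [Category.{v} Λ] (A : RightModule.{u, v, w} Λ)

/-- The abelian group `𝒜_v`. -/
abbrev at' (v : Λ) : Type w := A.obj (Opposite.op v)

/-- The homomorphism `𝒜(f) : 𝒜_{r(f)} → 𝒜_{s(f)}`. -/
def res {X Y : Λ} (f : X ⟶ Y) : A.at' Y →+ A.at' X := (A.map f.op).hom

/-- The component `𝒜_v → ℬ_v` of a morphism of modules. -/
def compAt {A B : RightModule.{u, v, w} Λ} (η : A ⟶ B) (v : Λ) : A.at' v →+ B.at' v :=
  (η.app (Opposite.op v)).hom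

variable {k : ℕ} [KGraph k Λ]

/-- The stalk at `x`: the direct limit of the groups `𝒜_{x(p)}`, `p ∈ ℕ^k`, along the
homomorphisms `𝒜(x(p, q))`, `p ≤ q`. -/
def Stalk (x : InfinitePath k Λ) : Type w :=
  AddCommGroup.DirectLimit (fun p : Fin k → ℕ => A.at' (x.obj p))
    (fun _ _ h => A.res (x.map h))

instance (x : InfinitePath k Λ) : AddCommGroup (A.Stalk x) :=
  inferInstanceAs (AddCommGroup (AddCommGroup.DirectLimit
    (fun p : Fin k → ℕ => A.at' (x.obj p)) (fun _ _ h => A.res (x.map h))))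

/-- The canonical homomorphism `φ^x_p : 𝒜_{x(p)} → lim_p 𝒜_{x(p)}`. -/
def toStalk (x : InfinitePath k Λ) (p : Fin k → ℕ) : A.at' (x.obj p) →+ A.Stalk x :=
  AddCommGroup.DirectLimit.of (fun p : Fin k → ℕ => A.at' (x.obj p))
    (fun _ _ h => A.res (x.map h)) p

theorem obj_eq_of_initial_eq {y : InfinitePath k Λ} {q : Fin k → ℕ} {l : Arrow Λ}
    (h : y.initial q = l) : y.obj q = l.left :=
  congrArg (fun f : Arrow Λ => f.left) h

/-- The set `S_{a, λ} = {φ^y_q(a) : y(0, q) = λ}` for `a ∈ 𝒜_{s(λ)}`. The equality `y(0, q) = λ`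
gives `y(q) = s(λ)`, and `a` is transported to `𝒜_{y(q)}` along this equality. -/
def basicSet (l : Arrow Λ) (a : A.at' l.left) :
    Set (EtaleSpace fun x : InfinitePath k Λ => A.Stalk x) :=
  {t | ∃ (y : InfinitePath k Λ) (q : Fin k → ℕ) (h : y.initial q = l),
    t = ⟨y, A.toStalk y q (A.res (eqToHom (obj_eq_of_initial_eq h)) a)⟩}

/-- The topology on the disjoint union of the stalks generated by the sets `S_{a, λ}`. -/
instance : TopologicalSpace (EtaleSpace fun x : InfinitePath k Λ => A.Stalk x) :=
  TopologicalSpace.generateFrom {U | ∃ (l : Arrow Λ) (a : A.at' l.left), U = A.basicSet l a}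

theorem obj_eq_of_shift_eq {x y : InfinitePath k Λ} {p q : Fin k → ℕ}
    (h : x.shift p = y.shift q) : x.obj p = y.obj q := by
  have := congrArg (fun z : InfinitePath k Λ => z.obj 0) h
  simpa [InfinitePath.shift] using this

/-- The `𝒢_Λ`-sheaf with stalks `A.Stalk x` and topology generated by the sets `S_{a, λ}`, given
the rest of the structure. -/
abbrev sheafOf (S : GroupoidSheafStructure fun x : InfinitePath k Λ => A.Stalk x) :
    GroupoidSheaf (InfinitePath k Λ) where
  stalk := fun x => A.Stalk x
  str := S

end RightModule

end

/-!
The stalk at an infinite path `x` is a direct limit over the directed set `ℕ^k`, so each of its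
elements has a representative `a ∈ 𝒜_{x(p)}` for all large `p`, and everything is checked on
representatives at sufficiently late stages.

*Topology.* By unique factorization, a path `y` with `y(0, q) = x(0, q)` also agrees with `x` on
all earlier segments. Hence restricting `a` to a later stage `q` shrinks `S_{a, x(0, p)}` to
`S_{a|q, x(0, q)}` (`initialSet_res_subset`), and since two representatives of the same element
agree at some later stage, these sets form a neighbourhood basis (`exists_initialSet_subset`). The
projection maps `S_{a, x(0, p)}` bijectively onto the cylinder `Z(x(0, p))`, which makes it a local
homeomorphism, and addition, negation and module morphisms carry basic sets into basic sets.

*Action.* If `σ^j(x) = σ^l(y)`, the groups from stage `l` on along `y` are those from stage `j` on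
along `x`, which gives a homomorphism of direct limits (`tailMap`). It depends only on the lag
`j - l` (`tailMap_toStalk`): for two pairs with the same lag, both homomorphisms have the same
representative at a common later stage. Functoriality of the action follows from this formula. The
action maps the part of `Z(x(0, p), y(0, q)) × S_{b, y(0, q)}` on which it is defined into
`S_{b, x(0, p)}`, so it is continuous.

*Exactness.* Direct limits over directed sets are exact, which gives exactness on stalks. For
exactness in the category of sheaves, the functor is shown to preserve kernels and cokernels. A
morphism of sheaves is a local homeomorphism on total spaces; if it is injective on stalks it is an
open embedding, and if it is surjective on stalks it is a quotient map. So the stalkwise lifts and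
extensions are continuous, and a stalkwise kernel or cokernel is one in the category of sheaves
(`nonempty_isLimit_of_stalk`, `nonempty_isColimit_of_stalk`).
-/

/-! ### Initial segments of infinite paths -/

namespace KGraph

variable {k : ℕ} {Λ : Type u} [Category.{v} Λ] [KGraph k Λ]

/-- Unique factorization, stated for arrows with varying endpoints: two factorizations of the same
arrow whose left factors have the same degree agree. -/
theorem arrow_mk_eq_of_comp_eq {X Z Y X' Z' Y' : Λ} (ν : X ⟶ Z) (μ : Z ⟶ Y) (ν' : X' ⟶ Z')
    (μ' : Z' ⟶ Y') (h : Arrow.mk (ν ≫ μ) = Arrow.mk (ν' ≫ μ'))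
    (hμ : degree (k := k) μ = degree μ') (hν : degree (k := k) ν = degree ν') :
    Arrow.mk μ = Arrow.mk μ' ∧ Arrow.mk ν = Arrow.mk ν' := by
  obtain rfl : X = X' := congrArg (fun f : Arrow Λ => f.left) h
  obtain rfl : Y = Y' := congrArg (fun f : Arrow Λ => f.right) h
  have h' : ν ≫ μ = ν' ≫ μ' := Arrow.mk_injective _ _ h
  obtain ⟨t, -, ht⟩ := factorization (ν ≫ μ) (degree (k := k) μ) (degree ν) (degree_comp _ _)
  have h1 := ht ⟨Z, μ, ν⟩ ⟨rfl, rfl, rfl⟩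
  have h2 := ht ⟨Z', μ', ν'⟩ ⟨h'.symm, hμ.symm, hν.symm⟩
  have h3 := h1.trans h2.symm
  simp only [Sigma.mk.injEq] at h3
  obtain ⟨rfl, h3⟩ := h3
  obtain ⟨rfl, rfl⟩ := Prod.ext_iff.1 (eq_of_heq h3)
  exact ⟨rfl, rfl⟩

end KGraph

namespace InfinitePath

variable {k : ℕ} {Λ : Type u} [Category.{v} Λ] [KGraph k Λ] {x y : InfinitePath k Λ}
  {p q r : Fin k → ℕ}

theorem degree_initial (x : InfinitePath k Λ) (p : Fin k → ℕ) :
    KGraph.degree (k := k) (x.initial p).hom = p :=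
  (x.degree_map _).trans (tsub_zero p)

/-- The degree of an initial segment determines where it ends. -/
theorem eq_of_initial_eq (h : y.initial q = x.initial p) : q = p := by
  rw [← degree_initial y q, h, degree_initial]

theorem mem_cylinder_initial : y ∈ cylinder (x.initial p) ↔ y.initial p = x.initial p := by
  rw [cylinder, Set.mem_ofPred_eq, degree_initial]

theorem initial_eq_and_map_eq (h : y.initial r = x.initial r) (hp : p ≤ r) :
    y.initial p = x.initial p ∧ Arrow.mk (y.map hp) = Arrow.mk (x.map hp) := by
  refine KGraph.arrow_mk_eq_of_comp_eq (k := k) (y.map hp) (y.map zero_le) (x.map hp)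
    (x.map zero_le) ?_ ?_ ?_
  · rw [← map_trans, ← map_trans]
    exact h
  · rw [degree_map, degree_map]
  · rw [degree_map, degree_map]

theorem initial_eq_of_le (h : y.initial r = x.initial r) (hp : p ≤ r) :
    y.initial p = x.initial p :=
  (initial_eq_and_map_eq h hp).1

theorem arrow_mk_map_congr (x : InfinitePath k Λ) {m n m' n' : Fin k → ℕ} (hm : m = m')
    (hn : n = n') (h : m ≤ n) (h' : m' ≤ n') : Arrow.mk (x.map h) = Arrow.mk (x.map h') := by
  subst hm hn
  rfl

theorem isOpen_cylinder (l : Arrow Λ) : IsOpen (cylinder (k := k) l) :=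
  TopologicalSpace.isOpen_generateFrom_of_mem ⟨l, rfl⟩

theorem shift_eq_add (h : x.shift p = y.shift q) (m : Fin k → ℕ) :
    x.shift (p + m) = y.shift (q + m) := by
  rw [← shift_shift, ← shift_shift, h]

theorem isOpen_groupoidCylinder {l m : Arrow Λ} (h : l.left = m.left) :
    IsOpen (groupoidCylinder (k := k) l m) :=
  TopologicalSpace.isOpen_generateFrom_of_mem ⟨l, m, h, rfl⟩

end InfinitePath

noncomputable section

namespace RightModule

variable {Λ : Type u} [Category.{v} Λ] (A : RightModule.{u, v, w} Λ)

/-! ### Restriction maps and stalks -/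

theorem res_id (X : Λ) (a : A.at' X) : A.res (𝟙 X) a = a := by
  simp [res]

theorem res_comp {X Y Z : Λ} (f : X ⟶ Y) (g : Y ⟶ Z) (a : A.at' Z) :
    A.res (f ≫ g) a = A.res f (A.res g a) := by
  simp [res]

theorem res_eqToHom_eqToHom {X Y Z : Λ} (h : X = Y) (h' : Y = Z) (a : A.at' Z) :
    A.res (eqToHom h) (A.res (eqToHom h') a) = A.res (eqToHom (h.trans h')) a := by
  rw [← res_comp, eqToHom_trans]

/-- Arrows that agree up to equality of their endpoints give the same restriction map, up to
transport along these equalities. -/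
theorem res_eqToHom_res {X Y X' Y' : Λ} {f : X ⟶ Y} {g : X' ⟶ Y'} (h : Arrow.mk f = Arrow.mk g)
    (hX : X = X') (hY : Y = Y') (a : A.at' Y') :
    A.res f (A.res (eqToHom hY) a) = A.res (eqToHom hX) (A.res g a) := by
  subst hX hY
  obtain rfl := Arrow.mk_injective _ _ h
  simp only [eqToHom_refl, res_id]

theorem compAt_res {A B : RightModule.{u, v, w} Λ} (η : A ⟶ B) {X Y : Λ} (f : X ⟶ Y)
    (a : A.at' Y) : compAt η X (A.res f a) = B.res f (compAt η Y a) :=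
  congrArg (fun g => g.hom a) (η.naturality f.op)

variable {k : ℕ} [KGraph k Λ] {x y z : InfinitePath k Λ} {p q r : Fin k → ℕ}

theorem toStalk_res (x : InfinitePath k Λ) (h : p ≤ q) (a : A.at' (x.obj p)) :
    A.toStalk x q (A.res (x.map h) a) = A.toStalk x p a :=
  AddCommGroup.DirectLimit.of_f (f := fun _ _ h => A.res (x.map h)) h a

theorem res_map_map (x : InfinitePath k Λ) (h : p ≤ q) (h' : q ≤ r) (a : A.at' (x.obj p)) :
    A.res (x.map h') (A.res (x.map h) a) = A.res (x.map (h.trans h')) a := by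
  rw [← res_comp, ← x.map_trans]

instance (x : InfinitePath k Λ) :
    DirectedSystem (fun p : Fin k → ℕ => A.at' (x.obj p)) (fun _ _ h => A.res (x.map h)) where
  map_self p a := by rw [x.map_refl, res_id]
  map_map _ _ _ h h' a := A.res_map_map x h h' a

/-- Every element of a stalk is represented at all sufficiently late stages. -/
theorem exists_toStalk_eq (x : InfinitePath k Λ) (p : Fin k → ℕ) (e : A.Stalk x) :
    ∃ q, p ≤ q ∧ ∃ a, A.toStalk x q a = e := by
  induction e using AddCommGroup.DirectLimit.induction_on with
  | ih q a => exact ⟨p ⊔ q, le_sup_left, A.res (x.map le_sup_right) a, A.toStalk_res x _ a⟩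

theorem exists_res_eq_zero {a : A.at' (x.obj p)} (h : A.toStalk x p a = 0) :
    ∃ q, ∃ hq : p ≤ q, A.res (x.map hq) a = 0 :=
  AddCommGroup.DirectLimit.of.zero_exact (f := fun _ _ h => A.res (x.map h)) p a h

theorem exists_res_eq_res {a : A.at' (x.obj p)} {b : A.at' (x.obj q)}
    (h : A.toStalk x p a = A.toStalk x q b) :
    ∃ r, ∃ (hp : p ≤ r) (hq : q ≤ r), A.res (x.map hp) a = A.res (x.map hq) b := by
  have h0 : A.toStalk x (p ⊔ q)
      (A.res (x.map le_sup_left) a - A.res (x.map le_sup_right) b) = 0 := by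
    rw [map_sub, toStalk_res, toStalk_res, h, sub_self]
  obtain ⟨r, hr, e⟩ := A.exists_res_eq_zero h0
  refine ⟨r, le_sup_left.trans hr, le_sup_right.trans hr, ?_⟩
  rw [map_sub, res_map_map, res_map_map] at e
  exact sub_eq_zero.1 e

variable {A} in
theorem stalk_hom_ext {M : Type*} [AddCommGroup M] {f g : A.Stalk x →+ M}
    (h : ∀ p a, f (A.toStalk x p a) = g (A.toStalk x p a)) : f = g := by
  ext e
  obtain ⟨p, -, a, rfl⟩ := A.exists_toStalk_eq x 0 e
  exact h p a

/-- The homomorphism out of a stalk given by a compatible family of homomorphisms. -/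
def stalkLift {M : Type*} [AddCommGroup M] (f : ∀ p, A.at' (x.obj p) →+ M)
    (hf : ∀ p q (h : p ≤ q) a, f q (A.res (x.map h) a) = f p a) : A.Stalk x →+ M :=
  AddCommGroup.DirectLimit.lift _ _ M f hf

theorem stalkLift_toStalk {M : Type*} [AddCommGroup M] (f : ∀ p, A.at' (x.obj p) →+ M)
    (hf : ∀ p q (h : p ≤ q) a, f q (A.res (x.map h) a) = f p a) (p : Fin k → ℕ)
    (a : A.at' (x.obj p)) : A.stalkLift f hf (A.toStalk x p a) = f p a :=
  AddCommGroup.DirectLimit.lift_of _ _ _ _ _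

theorem toStalk_eqToHom (x : InfinitePath k Λ) (hpq : p = q) (h : x.obj p = x.obj q)
    (a : A.at' (x.obj q)) : A.toStalk x p (A.res (eqToHom h) a) = A.toStalk x q a := by
  subst hpq
  rw [eqToHom_refl, res_id]

/-! ### The action of the path groupoid on stalks -/

theorem map_eq_of_shift_eq (h : x.shift p = y.shift q) {m n : Fin k → ℕ} (hmn : m ≤ n) :
    Arrow.mk (x.map (add_le_add_left hmn p)) = Arrow.mk (y.map (add_le_add_left hmn q)) :=
  congrArg (fun z : InfinitePath k Λ => Arrow.mk (z.map hmn)) h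

theorem obj_add_eq_of_shift_eq (h : x.shift p = y.shift q) (m : Fin k → ℕ) :
    x.obj (m + p) = y.obj (m + q) :=
  congrArg (fun z : InfinitePath k Λ => z.obj m) h

/-- The homomorphism of stalks given by a common tail `σ^p(x) = σ^q(y)`: it maps an element
represented at stage `m + q` of `y` to the element with the same representative at stage `m + p`
of `x`. -/
def tailMap (h : x.shift p = y.shift q) : A.Stalk y →+ A.Stalk x :=
  A.stalkLift
    (fun m => ((A.toStalk x (m + p)).comp (A.res (eqToHom (obj_add_eq_of_shift_eq h m)))).comp
      (A.res (y.map (le_add_of_nonneg_right zero_le))))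
    (fun m n hmn a => by
      simp only [AddMonoidHom.comp_apply]
      rw [← A.toStalk_res x (add_le_add_left hmn p),
        A.res_eqToHom_res (map_eq_of_shift_eq h hmn) (obj_add_eq_of_shift_eq h n),
        res_map_map, res_map_map])

theorem tailMap_toStalk_add (h : x.shift p = y.shift q) (m : Fin k → ℕ)
    (b : A.at' (y.obj (m + q))) :
    A.tailMap h (A.toStalk y (m + q) b) =
      A.toStalk x (m + p) (A.res (eqToHom (obj_add_eq_of_shift_eq h m)) b) := by
  have hm : m ≤ m + q := le_add_of_nonneg_right zero_le
  rw [tailMap, stalkLift_toStalk]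
  simp only [AddMonoidHom.comp_apply]
  have := A.res_eqToHom_res (map_eq_of_shift_eq h hm) (obj_add_eq_of_shift_eq h (m + q))
    (obj_add_eq_of_shift_eq h m) b
  rw [← this, toStalk_res]

/-- Two common tails with the same lag induce the same homomorphism of stalks. -/
theorem tailMap_toStalk {j l : Fin k → ℕ} (h : x.shift j = y.shift l)
    (hlag : ∀ i, (j i : ℤ) - l i = (p i : ℤ) - q i) (h' : x.shift p = y.shift q)
    (b : A.at' (y.obj q)) :
    A.tailMap h (A.toStalk y q b) =
      A.toStalk x p (A.res (eqToHom (obj_eq_of_shift_eq h')) b) := by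
  have e : l + p = q + j := funext fun i => by
    have := hlag i
    simp only [Pi.add_apply]
    omega
  have hq : q ≤ q + l := le_add_of_nonneg_right zero_le
  have hq' : 0 + q ≤ l + q := add_le_add_left zero_le q
  have hmap : Arrow.mk (y.map hq) = Arrow.mk (y.map hq') :=
    y.arrow_mk_map_congr (zero_add q).symm (add_comm q l) _ _
  have hp' : 0 + p ≤ l + p := add_le_add_left zero_le p
  -- Both sides are represented at stage `l + p = q + j` of `x` by the restriction of `b` to
  -- `y(q + l)`, transported along `y(q + l) = x(l + p)`.
  rw [← A.toStalk_res y hq b, tailMap_toStalk_add,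
    ← A.toStalk_eqToHom x (zero_add p) (congrArg x.obj (zero_add p)), res_eqToHom_eqToHom,
    ← A.toStalk_res x hp',
    A.res_eqToHom_res ((map_eq_of_shift_eq h' zero_le).trans hmap.symm)
      ((obj_add_eq_of_shift_eq h' l).trans (congrArg y.obj (add_comm l q))),
    ← A.toStalk_eqToHom x e (congrArg x.obj e), res_eqToHom_eqToHom]

/-- The homomorphism of stalks given by an element `γ` of the path groupoid. -/
def actHom (γ : y ⟶ x) : A.Stalk y →+ A.Stalk x :=
  A.tailMap (InfinitePath.GroupoidHom.exists_shift γ).choose_spec.choose_spec.2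

theorem actHom_toStalk (γ : y ⟶ x) (p q : Fin k → ℕ)
    (hlag : ∀ i, InfinitePath.lag γ i = (p i : ℤ) - (q i : ℤ)) (h : x.shift p = y.shift q)
    (b : A.at' (y.obj q)) :
    A.actHom γ (A.toStalk y q b) = A.toStalk x p (A.res (eqToHom (obj_eq_of_shift_eq h)) b) :=
  A.tailMap_toStalk _
    (fun i => ((InfinitePath.GroupoidHom.exists_shift γ).choose_spec.choose_spec.1 i).trans
      (hlag i)) h b

theorem actHom_id (x : InfinitePath k Λ) (a : A.Stalk x) : A.actHom (𝟙 x) a = a := by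
  obtain ⟨p, -, a, rfl⟩ := A.exists_toStalk_eq x 0 a
  rw [A.actHom_toStalk (𝟙 x) p p (fun i => (sub_self _).symm) rfl, eqToHom_refl, res_id]

/-- Far enough along the path `y`, an element of the stalk at `y` has a representative at a stage
from which on the tails of `x` and `y` agree. -/
theorem exists_toStalk_eq_and_shift_eq (γ : y ⟶ x) (p₀ q₀ : Fin k → ℕ) (e : A.Stalk y) :
    ∃ p q, p₀ ≤ p ∧ q₀ ≤ q ∧ (∀ i, InfinitePath.lag γ i = (p i : ℤ) - (q i : ℤ)) ∧
      x.shift p = y.shift q ∧ ∃ b, A.toStalk y q b = e := by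
  obtain ⟨j, l, hlag, h⟩ := InfinitePath.GroupoidHom.exists_shift γ
  obtain ⟨q, hq, b, rfl⟩ := A.exists_toStalk_eq y (l + p₀ + q₀) e
  obtain ⟨m, rfl⟩ := exists_add_of_le hq
  refine ⟨j + (p₀ + q₀ + m), l + (p₀ + q₀ + m), fun i => ?_, fun i => ?_, fun i => ?_,
    InfinitePath.shift_eq_add h _, ?_⟩
  · simp only [Pi.add_apply]; omega
  · simp only [Pi.add_apply]; omega
  · have : InfinitePath.lag γ i = _ := (hlag i).symm
    rw [this]
    simp only [Pi.add_apply]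
    omega
  · have e : l + (p₀ + q₀ + m) = l + p₀ + q₀ + m := by abel
    rw [e]
    exact ⟨b, rfl⟩

theorem actHom_comp (γ' : z ⟶ y) (γ : y ⟶ x) (a : A.Stalk z) :
    A.actHom (γ' ≫ γ) a = A.actHom γ (A.actHom γ' a) := by
  obtain ⟨j, l, hlag, h⟩ := InfinitePath.GroupoidHom.exists_shift γ
  obtain ⟨p, q, hp, -, hlag', h', b, rfl⟩ := A.exists_toStalk_eq_and_shift_eq γ' l 0 a
  obtain ⟨m, rfl⟩ := exists_add_of_le hp
  have h1 := InfinitePath.shift_eq_add h m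
  have hlag1 : ∀ i, InfinitePath.lag γ i = ((j + m) i : ℤ) - ((l + m) i : ℤ) := fun i => by
    have : InfinitePath.lag γ i = _ := (hlag i).symm
    rw [this]
    simp only [Pi.add_apply]
    omega
  have hlag2 : ∀ i, InfinitePath.lag (γ' ≫ γ) i = ((j + m) i : ℤ) - (q i : ℤ) := fun i => by
    have : InfinitePath.lag (γ' ≫ γ) i = InfinitePath.lag γ i + InfinitePath.lag γ' i := rfl
    rw [this, hlag1, hlag']
    omega
  rw [A.actHom_toStalk γ' _ _ hlag' h', A.actHom_toStalk γ _ _ hlag1 h1,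
    A.actHom_toStalk (γ' ≫ γ) _ _ hlag2 (h1.trans h'), res_eqToHom_eqToHom]

/-- The isomorphism of stalks given by an element `γ` of the path groupoid. -/
def actEquiv (γ : y ⟶ x) : A.Stalk y ≃+ A.Stalk x where
  __ := A.actHom γ
  invFun := A.actHom (Groupoid.inv γ)
  left_inv a := by
    change A.actHom (Groupoid.inv γ) (A.actHom γ a) = a
    rw [← actHom_comp, Groupoid.comp_inv, actHom_id]
  right_inv a := by
    change A.actHom γ (A.actHom (Groupoid.inv γ) a) = a
    rw [← actHom_comp, Groupoid.inv_comp, actHom_id]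

end RightModule

namespace RightModule

variable {Λ : Type u} [Category.{v} Λ] {A : RightModule.{u, v, w} Λ} {k : ℕ} [KGraph k Λ]
  {x y : InfinitePath k Λ} {p q r : Fin k → ℕ}

/-! ### The topology on the disjoint union of the stalks -/

/-- The disjoint union of the stalks of a module. -/
abbrev Total (k : ℕ) [KGraph k Λ] (A : RightModule.{u, v, w} Λ) : Type (max u v w) :=
  EtaleSpace fun x : InfinitePath k Λ => A.Stalk x

theorem obj_eq_of_initial_eq_initial (h : y.initial p = x.initial p) : y.obj p = x.obj p :=
  congrArg (fun f : Arrow Λ => f.left) h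

/-- The set `S_{a, x(0, p)}` for `a ∈ 𝒜_{x(p)}`. Indexing basic sets by a path and a stage instead
of an arrow keeps the group containing `a` in the form in which it occurs in the limit. -/
def initialSet (x : InfinitePath k Λ) (p : Fin k → ℕ) (a : A.at' (x.obj p)) : Set (A.Total k) :=
  A.basicSet (x.initial p) a

theorem mk_mem_initialSet {a : A.at' (x.obj p)} {e : A.Stalk y} :
    (⟨y, e⟩ : A.Total k) ∈ initialSet x p a ↔
      ∃ h : y.initial p = x.initial p,
        e = A.toStalk y p (A.res (eqToHom (obj_eq_of_initial_eq_initial h)) a) := by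
  constructor
  · rintro ⟨y', q, h, he⟩
    obtain rfl := InfinitePath.eq_of_initial_eq h
    obtain rfl : y = y' := congrArg EtaleSpace.base he
    simp only [EtaleSpace.mk.injEq, heq_eq_eq, true_and] at he
    exact ⟨h, he⟩
  · rintro ⟨h, rfl⟩
    exact ⟨y, p, h, rfl⟩

theorem mk_toStalk_mem_initialSet (x : InfinitePath k Λ) (p : Fin k → ℕ) (a : A.at' (x.obj p)) :
    (⟨x, A.toStalk x p a⟩ : A.Total k) ∈ initialSet x p a :=
  mk_mem_initialSet.2 ⟨rfl, by rw [eqToHom_refl, res_id]⟩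

theorem isOpen_initialSet (x : InfinitePath k Λ) (p : Fin k → ℕ) (a : A.at' (x.obj p)) :
    IsOpen (initialSet x p a) :=
  TopologicalSpace.isOpen_generateFrom_of_mem ⟨x.initial p, a, rfl⟩

theorem initialSet_mem_nhds (x : InfinitePath k Λ) (p : Fin k → ℕ) (a : A.at' (x.obj p)) :
    initialSet x p a ∈ 𝓝 (⟨x, A.toStalk x p a⟩ : A.Total k) :=
  (isOpen_initialSet x p a).mem_nhds (mk_toStalk_mem_initialSet x p a)

/-- A basic set containing a point over `x` can be indexed by an initial segment of `x`. -/
theorem basicSet_eq_of_mem {l : Arrow Λ} {a : A.at' l.left} {e : A.Stalk x}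
    (h : (⟨x, e⟩ : A.Total k) ∈ A.basicSet l a) :
    ∃ (p : Fin k → ℕ) (b : A.at' (x.obj p)),
      A.toStalk x p b = e ∧ A.basicSet (k := k) l a = initialSet x p b := by
  obtain ⟨y, p, hl, he⟩ := h
  obtain rfl : x = y := congrArg EtaleSpace.base he
  subst hl
  simp only [EtaleSpace.mk.injEq, heq_eq_eq, true_and] at he
  refine ⟨p, a, ?_, rfl⟩
  rw [he]
  exact congrArg _ (A.res_id (x.obj p) a).symm

/-- Representatives at stage `p` agree with their restrictions to stage `q`, for all paths with
initial segment `x(0, q)`. -/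
theorem toStalk_res_of_initial_eq (hpq : p ≤ q) (h : y.initial q = x.initial q)
    (a : A.at' (x.obj p)) :
    A.toStalk y q (A.res (eqToHom (obj_eq_of_initial_eq_initial h)) (A.res (x.map hpq) a)) =
      A.toStalk y p (A.res (eqToHom (obj_eq_of_initial_eq_initial
        (InfinitePath.initial_eq_of_le h hpq))) a) := by
  obtain ⟨h', hm⟩ := InfinitePath.initial_eq_and_map_eq h hpq
  rw [← A.res_eqToHom_res hm _ (obj_eq_of_initial_eq_initial h'), toStalk_res]

theorem initialSet_res_subset (x : InfinitePath k Λ) (hpq : p ≤ q) (a : A.at' (x.obj p)) :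
    initialSet x q (A.res (x.map hpq) a) ⊆ initialSet x p a := by
  rintro ⟨y, e⟩ h
  obtain ⟨hy, rfl⟩ := mk_mem_initialSet.1 h
  exact mk_mem_initialSet.2
    ⟨InfinitePath.initial_eq_of_le hy hpq, toStalk_res_of_initial_eq hpq hy a⟩

/-- The sets `S_{b, x(0, q)}` with `φ^x_q(b) = e` form a neighbourhood basis of the point `e` over
`x`, and it suffices to take for `b` the restrictions of a fixed representative `a` of `e`. -/
theorem exists_initialSet_subset {U : Set (A.Total k)} {a : A.at' (x.obj p)} (hU : IsOpen U)
    (h : (⟨x, A.toStalk x p a⟩ : A.Total k) ∈ U) :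
    ∃ q, ∃ hpq : p ≤ q, initialSet x q (A.res (x.map hpq) a) ⊆ U := by
  induction hU with
  | basic U hU =>
    obtain ⟨l, b, rfl⟩ := hU
    obtain ⟨q, c, hc, hl⟩ := basicSet_eq_of_mem h
    obtain ⟨r, hq, hp, e⟩ := A.exists_res_eq_res hc
    refine ⟨r, hp, ?_⟩
    rw [hl, ← e]
    exact initialSet_res_subset x hq c
  | univ => exact ⟨p, le_rfl, Set.subset_univ _⟩
  | inter U V _ _ ihU ihV =>
    obtain ⟨q, hq, hqU⟩ := ihU h.1
    obtain ⟨r, hr, hrV⟩ := ihV h.2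
    refine ⟨q ⊔ r, hq.trans le_sup_left, Set.subset_inter ?_ ?_⟩
    · have := initialSet_res_subset x (le_sup_left : q ≤ q ⊔ r) (A.res (x.map hq) a)
      rw [res_map_map] at this
      exact this.trans hqU
    · have := initialSet_res_subset x (le_sup_right : r ≤ q ⊔ r) (A.res (x.map hr) a)
      rw [res_map_map] at this
      exact this.trans hrV
  | sUnion S _ ih =>
    obtain ⟨U, hU, hx⟩ := h
    obtain ⟨q, hq, hqU⟩ := ih U hU hx
    exact ⟨q, hq, hqU.trans (Set.subset_sUnion_of_mem hU)⟩

/-- Continuity at a point of a map to the disjoint union of the stalks may be tested on the basic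
sets at late stages, starting from any representative of the value. -/
theorem continuousAt_of_initialSet {T : Type*} [TopologicalSpace T] {f : T → A.Total k} {t : T}
    {a : A.at' (x.obj p)} (ht : f t = ⟨x, A.toStalk x p a⟩)
    (h : ∀ q (hpq : p ≤ q), f ⁻¹' initialSet x q (A.res (x.map hpq) a) ∈ 𝓝 t) :
    ContinuousAt f t := by
  intro V hV
  obtain ⟨U, hUV, hU, htU⟩ := mem_nhds_iff.1 hV
  rw [ht] at htU
  obtain ⟨q, hq, hqU⟩ := exists_initialSet_subset hU htU
  exact Filter.mem_of_superset (h q hq) (Set.preimage_mono (hqU.trans hUV))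

variable (k A) in
theorem continuous_total_base : Continuous (EtaleSpace.base : A.Total k → InfinitePath k Λ) := by
  refine continuous_generateFrom_iff.2 ?_
  rintro _ ⟨l, rfl⟩
  rw [isOpen_iff_mem_nhds]
  rintro ⟨x, e⟩ (hx : x.initial _ = l)
  obtain ⟨p, hp, a, rfl⟩ := A.exists_toStalk_eq x (KGraph.degree l.hom) e
  refine Filter.mem_of_superset (initialSet_mem_nhds x p a) ?_
  rintro ⟨y, e⟩ h
  obtain ⟨hy, -⟩ := mk_mem_initialSet.1 h
  exact (InfinitePath.initial_eq_of_le hy hp).trans hx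

variable (k A) in
theorem isOpenMap_total_base : IsOpenMap (EtaleSpace.base : A.Total k → InfinitePath k Λ) := by
  refine IsOpenMap.of_nhds_le ?_
  rintro ⟨x, e⟩ V hV
  obtain ⟨U, hUV, hU, htU⟩ := mem_nhds_iff.1 (Filter.mem_map.1 hV)
  obtain ⟨p, -, a, rfl⟩ := A.exists_toStalk_eq x 0 e
  obtain ⟨q, hq, hqU⟩ := exists_initialSet_subset hU htU
  refine Filter.mem_of_superset ((InfinitePath.isOpen_cylinder (x.initial q)).mem_nhds
    (InfinitePath.mem_cylinder_initial.2 rfl)) fun y hy => ?_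
  exact hUV (hqU (mk_mem_initialSet.2 ⟨InfinitePath.mem_cylinder_initial.1 hy, rfl⟩))

variable (k A) in
/-- The projection maps the basic open set `S_{a, x(0, p)}` bijectively onto `Z(x(0, p))`. -/
theorem isLocalHomeomorph_total_base :
    IsLocalHomeomorph (EtaleSpace.base : A.Total k → InfinitePath k Λ) := by
  rw [isLocalHomeomorph_iff_isOpenEmbedding_restrict]
  rintro ⟨x, e⟩
  obtain ⟨p, -, a, rfl⟩ := A.exists_toStalk_eq x 0 e
  refine ⟨_, initialSet_mem_nhds x p a,
    Topology.IsOpenEmbedding.of_continuous_injective_isOpenMap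
      ((continuous_total_base A k).comp continuous_subtype_val) ?_
      ((isOpenMap_total_base A k).comp (isOpen_initialSet x p a).isOpenMap_subtype_val)⟩
  rintro ⟨⟨y, e⟩, h⟩ ⟨⟨y', e'⟩, h'⟩ hyy
  obtain rfl : y = y' := hyy
  obtain ⟨_, rfl⟩ := mk_mem_initialSet.1 h
  obtain ⟨_, rfl⟩ := mk_mem_initialSet.1 h'
  rfl

/-! ### The sheaf of a module -/

/-- A map between disjoint unions of stalks which is given on representatives by maps
`𝒜_v → ℬ_v` compatible with restrictions is continuous. -/
theorem continuous_of_natural {B : RightModule.{u, v, w} Λ} (F : ∀ x : InfinitePath k Λ,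
    A.Stalk x → B.Stalk x) (g : ∀ v : Λ, A.at' v → B.at' v)
    (hF : ∀ x p a, F x (A.toStalk x p a) = B.toStalk x p (g _ a))
    (hg : ∀ {X Y : Λ} (f : X ⟶ Y) a, g X (A.res f a) = B.res f (g Y a)) :
    Continuous (fun t : A.Total k => (⟨t.base, F t.base t.elt⟩ : B.Total k)) := by
  refine continuous_iff_continuousAt.2 ?_
  rintro ⟨x, e⟩
  obtain ⟨p, -, a, rfl⟩ := A.exists_toStalk_eq x 0 e
  refine continuousAt_of_initialSet (congrArg (EtaleSpace.mk x) (hF x p a)) fun r hr => ?_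
  rw [← A.toStalk_res x hr a, ← hg]
  refine Filter.mem_of_superset (initialSet_mem_nhds x r _) ?_
  rintro ⟨y, b⟩ h
  obtain ⟨hy, rfl⟩ := mk_mem_initialSet.1 h
  refine mk_mem_initialSet.2 ⟨hy, ?_⟩
  dsimp only
  rw [hF, hg]

variable (k A) in
/-- The `𝒢_Λ`-sheaf structure on the stalks of a module. -/
def sheafStructure : GroupoidSheafStructure (fun x : InfinitePath k Λ => A.Stalk x) where
  isLocalHomeomorph_base := isLocalHomeomorph_total_base A k
  continuous_add := by
    let : TopologicalSpace (Σ x : InfinitePath k Λ, A.Stalk x × A.Stalk x) :=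
      TopologicalSpace.induced
        (fun t : (Σ x : InfinitePath k Λ, A.Stalk x × A.Stalk x) =>
          ((⟨t.1, t.2.1⟩, ⟨t.1, t.2.2⟩) : A.Total k × A.Total k)) inferInstance
    refine continuous_iff_continuousAt.2 ?_
    rintro ⟨x, e, e'⟩
    obtain ⟨p, -, a, rfl⟩ := A.exists_toStalk_eq x 0 e
    obtain ⟨q, hq, a', rfl⟩ := A.exists_toStalk_eq x p e'
    rw [← A.toStalk_res x hq a]
    generalize A.res (x.map hq) a = a
    refine continuousAt_of_initialSet (x := x) (p := q) (a := a + a') (by rw [map_add])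
      fun r hr => ?_
    rw [← A.toStalk_res x hr a, ← A.toStalk_res x hr a', map_add]
    generalize A.res (x.map hr) a = a
    generalize A.res (x.map hr) a' = a'
    rw [nhds_induced]
    refine ⟨_, prod_mem_nhds (initialSet_mem_nhds x r a) (initialSet_mem_nhds x r a'), ?_⟩
    rintro ⟨y, b, b'⟩ ⟨h, h'⟩
    dsimp only at h h'
    obtain ⟨hy, rfl⟩ := mk_mem_initialSet.1 h
    obtain ⟨_, rfl⟩ := mk_mem_initialSet.1 h'
    exact mk_mem_initialSet.2 ⟨hy, by rw [map_add, map_add]⟩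
  continuous_neg := continuous_of_natural (fun _ e => -e) (fun _ a => -a)
    (fun _ _ _ => (map_neg _ _).symm) (fun _ _ => (map_neg _ _).symm)
  act := A.actEquiv
  act_id := A.actHom_id
  act_comp := A.actHom_comp
  continuous_act := by
    let : TopologicalSpace (Σ γ : Arrow (InfinitePath k Λ), A.Stalk γ.left) :=
      TopologicalSpace.induced
        (fun t : (Σ γ : Arrow (InfinitePath k Λ), A.Stalk γ.left) =>
          ((t.1, ⟨t.1.left, t.2⟩) : Arrow (InfinitePath k Λ) × A.Total k)) inferInstance
    refine continuous_iff_continuousAt.2 ?_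
    rintro ⟨⟨y, x, γ⟩, e⟩
    dsimp only [Functor.id_obj] at γ e
    obtain ⟨p, q, -, -, hlag, h, b, rfl⟩ := A.exists_toStalk_eq_and_shift_eq γ 0 0 e
    have hxy := obj_eq_of_shift_eq h
    refine continuousAt_of_initialSet (x := x) (p := p) (a := A.res (eqToHom hxy) b)
      (congrArg (EtaleSpace.mk x) (A.actHom_toStalk γ p q hlag h b)) fun r hr => ?_
    -- The inverse image of `S_{b, x(0, p)}` contains the trace of
    -- `Z(x(0, p), y(0, q)) × S_{b, y(0, q)}`; to pass from `p` to a later stage `p + m`, pass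
    -- from `q` to `q + m`.
    obtain ⟨m, rfl⟩ := exists_add_of_le hr
    have hq : q ≤ q + m := le_add_of_nonneg_right zero_le
    have h' := InfinitePath.shift_eq_add h m
    have hxy' := obj_eq_of_shift_eq h'
    have hlag' : ∀ i, InfinitePath.lag γ i = ((p + m) i : ℤ) - ((q + m) i : ℤ) := fun i => by
      rw [hlag]
      simp only [Pi.add_apply]
      omega
    have hmap : Arrow.mk (x.map hr) = Arrow.mk (y.map hq) :=
      (x.arrow_mk_map_congr (zero_add p).symm (add_comm p m) _ _).trans
        ((map_eq_of_shift_eq h (zero_le (a := m))).trans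
          (y.arrow_mk_map_congr (zero_add q) (add_comm m q) _ _))
    rw [← A.toStalk_res y hq b, A.res_eqToHom_res hmap hxy' hxy]
    generalize A.res (y.map hq) b = b
    have hZ : InfinitePath.groupoidCylinder (x.initial (p + m)) (y.initial (q + m)) ∈
        𝓝 (Arrow.mk γ) := by
      refine (InfinitePath.isOpen_groupoidCylinder hxy').mem_nhds ⟨?_, ?_, ?_, ?_⟩
      · exact InfinitePath.mem_cylinder_initial.2 rfl
      · exact InfinitePath.mem_cylinder_initial.2 rfl
      · rw [InfinitePath.degree_initial, InfinitePath.degree_initial]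
        exact hlag'
      · rw [InfinitePath.degree_initial, InfinitePath.degree_initial]
        exact h'
    rw [nhds_induced]
    refine ⟨_, prod_mem_nhds hZ (initialSet_mem_nhds y (q + m) b), ?_⟩
    rintro ⟨⟨y', x', γ'⟩, e'⟩ ⟨⟨hx', -, hlagγ, hs⟩, he'⟩
    dsimp only [Functor.id_obj] at γ' e' hx' hs hlagγ he'
    obtain ⟨hy', rfl⟩ := mk_mem_initialSet.1 he'
    simp only [InfinitePath.degree_initial] at hlagγ hs
    refine mk_mem_initialSet.2 ⟨InfinitePath.mem_cylinder_initial.1 hx', ?_⟩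
    refine (A.actHom_toStalk γ' _ _ hlagγ hs _).trans ?_
    rw [res_eqToHom_eqToHom, res_eqToHom_eqToHom]

end RightModule

/-! ### Kernels and cokernels of sheaves over a groupoid -/

namespace GroupoidSheaf

open Limits

variable {X : Type u} [TopologicalSpace X] [Groupoid.{v} X] [TopologicalSpace (Arrow X)]
  {A B C : GroupoidSheaf.{u, v, w} X}

theorem stalkMap_comp_apply (f : A ⟶ B) (g : B ⟶ C) (x : X) (a : A.stalk x) :
    stalkMap (f ≫ g) x a = stalkMap g x (stalkMap f x a) := rfl

theorem stalkMap_zero_apply (x : X) (a : A.stalk x) :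
    stalkMap (0 : A ⟶ B) x a = 0 := rfl

theorem stalkMap_act (f : A ⟶ B) {x y : X} (γ : y ⟶ x) (a : A.stalk y) :
    stalkMap f x (A.str.act γ a) = B.str.act γ (stalkMap f y a) :=
  Hom.equivariant f γ a

/-- The map of total spaces given by a morphism of sheaves. -/
def totalMap (f : A ⟶ B) (t : EtaleSpace A.stalk) : EtaleSpace B.stalk :=
  ⟨t.base, stalkMap f t.base t.elt⟩

theorem continuous_totalMap (f : A ⟶ B) : Continuous (totalMap f) :=
  Hom.continuous_app f

/-- A continuous map over `X` between spaces which are locally homeomorphic to `X` is a local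
homeomorphism. -/
theorem isLocalHomeomorph_totalMap (f : A ⟶ B) : IsLocalHomeomorph (totalMap f) :=
  IsLocalHomeomorph.of_comp (f := totalMap f) (g := EtaleSpace.base)
    A.str.isLocalHomeomorph_base B.str.isLocalHomeomorph_base (continuous_totalMap f)

theorem isOpenEmbedding_totalMap (f : A ⟶ B) (hf : ∀ x, Function.Injective (stalkMap f x)) :
    Topology.IsOpenEmbedding (totalMap f) := by
  refine (isLocalHomeomorph_totalMap f).isOpenEmbedding_of_injective ?_
  rintro ⟨x, a⟩ ⟨y, b⟩ h
  obtain rfl : x = y := congrArg EtaleSpace.base h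
  simp only [totalMap, EtaleSpace.mk.injEq, heq_eq_eq, true_and] at h
  rw [hf x h]

theorem isQuotientMap_totalMap (f : A ⟶ B) (hf : ∀ x, Function.Surjective (stalkMap f x)) :
    Topology.IsQuotientMap (totalMap f) := by
  refine (isLocalHomeomorph_totalMap f).isOpenMap.isQuotientMap (continuous_totalMap f) ?_
  rintro ⟨x, b⟩
  obtain ⟨a, rfl⟩ := hf x b
  exact ⟨⟨x, a⟩, rfl⟩

/-- A morphism which is stalkwise a kernel of `g` is a kernel of `g`: the lift of a morphism, which
is determined on stalks, is continuous because the total space of the kernel has the subspace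
topology. -/
theorem nonempty_isLimit_of_stalk (i : A ⟶ B) (g : B ⟶ C) (w : i ≫ g = 0)
    (hi : ∀ x, Function.Injective (stalkMap i x))
    (h : ∀ x, Function.Exact (stalkMap i x) (stalkMap g x)) :
    Nonempty (IsLimit (KernelFork.ofι i w)) := by
  have key {D : GroupoidSheaf.{u, v, w} X} (f : D ⟶ B) (hf : f ≫ g = 0) :
      ∃ l : D ⟶ A, l ≫ i = f := by
    have hex (x : X) (d : D.stalk x) : ∃ a, stalkMap i x a = stalkMap f x d :=
      (h x _).1 (by rw [← stalkMap_comp_apply, hf, stalkMap_zero_apply])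
    choose l hl using hex
    refine ⟨⟨fun x => ⟨⟨l x, hi x ?_⟩, fun a b => hi x ?_⟩, ?_, fun {y x} γ a => hi x ?_⟩,
      hom_ext fun x => AddMonoidHom.ext (hl x)⟩
    · rw [hl, map_zero, map_zero]
    · rw [map_add, hl]
      dsimp only
      rw [hl, hl, map_add]
    · refine (isOpenEmbedding_totalMap i hi).continuous_iff.2 ?_
      refine (continuous_totalMap f).congr fun t => ?_
      exact congrArg (EtaleSpace.mk t.base) (hl t.base t.elt).symm
    · refine (hl _ _).trans ?_
      rw [stalkMap_act, stalkMap_act]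
      exact congrArg _ (hl _ _).symm
  have hm : Mono i := ⟨fun a b hab => hom_ext fun x => AddMonoidHom.ext fun d => hi x <| by
    rw [← stalkMap_comp_apply, hab, stalkMap_comp_apply]⟩
  choose l hl using @key
  exact ⟨KernelFork.IsLimit.ofι i w (fun f hf => l f hf) (fun f hf => hl f hf)
    fun f hf m hm' => (cancel_mono i).1 (hm'.trans (hl f hf).symm)⟩

/-- A morphism which is stalkwise a cokernel of `f` is a cokernel of `f`: the extension of a
morphism, which is determined on stalks, is continuous because the total space of the cokernel has
the quotient topology. -/
theorem nonempty_isColimit_of_stalk (f : A ⟶ B) (p : B ⟶ C) (w : f ≫ p = 0)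
    (hp : ∀ x, Function.Surjective (stalkMap p x))
    (h : ∀ x, Function.Exact (stalkMap f x) (stalkMap p x)) :
    Nonempty (IsColimit (CokernelCofork.ofπ p w)) := by
  have key {D : GroupoidSheaf.{u, v, w} X} (g : B ⟶ D) (hg : f ≫ g = 0) :
      ∃ l : C ⟶ D, p ≫ l = g := by
    have hex (x : X) : (stalkMap p x).ker ≤ (stalkMap g x).ker := by
      intro b hb
      obtain ⟨a, rfl⟩ := (h x b).1 hb
      rw [AddMonoidHom.mem_ker, ← stalkMap_comp_apply, hg, stalkMap_zero_apply]
    let l (x : X) : C.stalk x →+ D.stalk x :=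
      (stalkMap p x).liftOfSurjective (hp x) ⟨stalkMap g x, hex x⟩
    have hl (x : X) (b : B.stalk x) : l x (stalkMap p x b) = stalkMap g x b :=
      AddMonoidHom.liftOfRightInverse_comp_apply _ _ _ ⟨stalkMap g x, hex x⟩ b
    refine ⟨⟨l, ?_, fun {y x} γ c => ?_⟩, hom_ext fun x => AddMonoidHom.ext (hl x)⟩
    · refine (isQuotientMap_totalMap p hp).continuous_iff.2 ?_
      refine (continuous_totalMap g).congr fun t => ?_
      exact congrArg (EtaleSpace.mk t.base) (hl t.base t.elt).symm
    · obtain ⟨b, rfl⟩ := hp y c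
      rw [← stalkMap_act, hl, hl, stalkMap_act]
  have he : Epi p := ⟨fun a b hab => hom_ext fun x => AddMonoidHom.ext fun c => by
    obtain ⟨d, rfl⟩ := hp x c
    rw [← stalkMap_comp_apply, hab, stalkMap_comp_apply]⟩
  choose l hl using @key
  exact ⟨CokernelCofork.IsColimit.ofπ p w (fun f hf => l f hf) (fun f hf => hl f hf)
    fun f hf m hm' => (cancel_epi p).1 (hm'.trans (hl f hf).symm)⟩

end GroupoidSheaf

/-! ### Exact sequences of modules -/

namespace RightModule

open Limits

variable {Λ : Type u} [Category.{v} Λ]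

/-- Exactness of modules is tested at each object. -/
theorem exact_iff (T : ShortComplex (RightModule.{u, v, w} Λ)) :
    T.Exact ↔ ∀ X : Λ, Function.Exact (compAt T.f X) (compAt T.g X) := by
  have key (X : Λ) : (T.map ((evaluation _ _).obj (Opposite.op X))).Exact ↔
      Function.Exact (compAt T.f X) (compAt T.g X) :=
    ShortComplex.ab_exact_iff_function_exact _
  simp only [← key]
  refine ⟨fun h X => h.map _, fun h => ?_⟩
  rw [ShortComplex.exact_iff_isZero_homology]
  refine Functor.isZero _ fun X => ?_
  have := (ShortComplex.exact_iff_isZero_homology _).1 (h X.unop)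
  exact this.of_iso (T.mapHomologyIso ((evaluation _ _).obj X)).symm

theorem compAt_injective {A B : RightModule.{u, v, w} Λ} (η : A ⟶ B) [Mono η] (X : Λ) :
    Function.Injective (compAt η X) :=
  (AddCommGrpCat.mono_iff_injective (η.app (Opposite.op X))).1 inferInstance

theorem compAt_surjective {A B : RightModule.{u, v, w} Λ} (η : A ⟶ B) [Epi η] (X : Λ) :
    Function.Surjective (compAt η X) :=
  (AddCommGrpCat.epi_iff_surjective (η.app (Opposite.op X))).1 inferInstance

/-! ### The functor from modules to sheaves -/

variable {k : ℕ} [KGraph k Λ] {A B C : RightModule.{u, v, w} Λ} {x : InfinitePath k Λ}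

/-- The homomorphism of stalks given by a morphism of modules. -/
def stalkHom (η : A ⟶ B) (x : InfinitePath k Λ) : A.Stalk x →+ B.Stalk x :=
  A.stalkLift (fun p => (B.toStalk x p).comp (compAt η (x.obj p))) fun p q h a => by
    rw [AddMonoidHom.comp_apply, compAt_res, toStalk_res, AddMonoidHom.comp_apply]

theorem stalkHom_toStalk (η : A ⟶ B) (x : InfinitePath k Λ) (p : Fin k → ℕ)
    (a : A.at' (x.obj p)) :
    stalkHom η x (A.toStalk x p a) = B.toStalk x p (compAt η (x.obj p) a) :=
  A.stalkLift_toStalk _ _ p a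

/-- Direct limits over a directed set are exact. -/
theorem stalkHom_exact {η : A ⟶ B} {θ : B ⟶ C}
    (h : ∀ X : Λ, Function.Exact (compAt η X) (compAt θ X)) (x : InfinitePath k Λ) :
    Function.Exact (stalkHom η x) (stalkHom θ x) := by
  intro e
  constructor
  · intro he
    obtain ⟨p, -, b, rfl⟩ := B.exists_toStalk_eq x 0 e
    rw [stalkHom_toStalk] at he
    obtain ⟨q, hq, hb⟩ := C.exists_res_eq_zero he
    rw [← compAt_res] at hb
    obtain ⟨a, ha⟩ := (h _ _).1 hb
    exact ⟨A.toStalk x q a, by rw [stalkHom_toStalk, ha, toStalk_res]⟩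
  · rintro ⟨d, rfl⟩
    obtain ⟨p, -, a, rfl⟩ := A.exists_toStalk_eq x 0 d
    rw [stalkHom_toStalk, stalkHom_toStalk, (h _ _).2 ⟨a, rfl⟩, map_zero]

theorem stalkHom_injective (η : A ⟶ B) [Mono η] (x : InfinitePath k Λ) :
    Function.Injective (stalkHom η x) := by
  rw [injective_iff_map_eq_zero]
  intro e he
  obtain ⟨p, -, a, rfl⟩ := A.exists_toStalk_eq x 0 e
  rw [stalkHom_toStalk] at he
  obtain ⟨q, hq, ha⟩ := B.exists_res_eq_zero he
  rw [← compAt_res] at ha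
  rw [← A.toStalk_res x hq, (injective_iff_map_eq_zero _).1 (compAt_injective η _) _ ha, map_zero]

theorem stalkHom_surjective (η : A ⟶ B) [Epi η] (x : InfinitePath k Λ) :
    Function.Surjective (stalkHom η x) := by
  intro e
  obtain ⟨p, -, b, rfl⟩ := B.exists_toStalk_eq x 0 e
  obtain ⟨a, rfl⟩ := compAt_surjective η _ b
  exact ⟨A.toStalk x p a, stalkHom_toStalk η x p a⟩

variable (k) in
/-- The morphism of `𝒢_Λ`-sheaves given by a morphism of modules. -/
def sheafHom (η : A ⟶ B) : A.sheafOf (sheafStructure A k) ⟶ B.sheafOf (sheafStructure B k) where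
  app := stalkHom η
  continuous_app := continuous_of_natural (fun x e => stalkHom η x e) (fun X => compAt η X)
    (fun _ _ _ => stalkHom_toStalk η _ _ _) (compAt_res η)
  equivariant {y x} γ e := by
    obtain ⟨p, q, -, -, hlag, h, a, rfl⟩ := A.exists_toStalk_eq_and_shift_eq γ 0 0 e
    change stalkHom η x (A.actHom γ (A.toStalk y q a)) =
      B.actHom γ (stalkHom η y (A.toStalk y q a))
    rw [A.actHom_toStalk γ p q hlag h, stalkHom_toStalk, stalkHom_toStalk,
      B.actHom_toStalk γ p q hlag h, compAt_res]

variable (k Λ) in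
/-- The functor from right `Λ`-modules to `𝒢_Λ`-sheaves. -/
def sheafFunctor : RightModule.{u, v, w} Λ ⥤ GroupoidSheaf (InfinitePath k Λ) where
  obj A := A.sheafOf (sheafStructure A k)
  map η := sheafHom k η
  map_id A := GroupoidSheaf.hom_ext fun x => stalk_hom_ext fun p a =>
    stalkHom_toStalk (𝟙 A) x p a
  map_comp η θ := GroupoidSheaf.hom_ext fun x => stalk_hom_ext fun p a =>
    (stalkHom_toStalk (η ≫ θ) x p a).trans
      ((congrArg (stalkHom θ x) (stalkHom_toStalk η x p a)).trans
        (stalkHom_toStalk θ x p _)).symm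

instance : (sheafFunctor.{u, v, w} Λ k).Additive where
  map_add {A B η θ} := GroupoidSheaf.hom_ext fun x => stalk_hom_ext fun p a => by
    refine (stalkHom_toStalk (η + θ) x p a).trans ?_
    have h : compAt (η + θ) (x.obj p) a = compAt η (x.obj p) a + compAt θ (x.obj p) a := rfl
    rw [h, map_add, ← stalkHom_toStalk, ← stalkHom_toStalk]
    rfl

/-- Kernels and cokernels of modules are kernels and cokernels at each object, hence on stalks,
hence for sheaves. -/
instance : (sheafFunctor.{u, v, w} Λ k).PreservesHomology where
  preservesKernels A B g := by
    refine preservesLimit_of_preserves_limit_cone (kernelIsKernel g) ?_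
    refine (isLimitMapConeForkEquiv' _ (kernel.condition g)).symm ?_
    have hex := (exact_iff (ShortComplex.mk _ _ (kernel.condition g))).1
      (ShortComplex.exact_kernel g)
    exact (GroupoidSheaf.nonempty_isLimit_of_stalk
      ((sheafFunctor Λ k).map (kernel.ι g)) ((sheafFunctor Λ k).map g) _
      (fun x => stalkHom_injective (kernel.ι g) x) fun x => stalkHom_exact hex x).some
  preservesCokernels A B f := by
    refine preservesColimit_of_preserves_colimit_cocone (cokernelIsCokernel f) ?_
    refine (isColimitMapCoconeCoforkEquiv' _ (cokernel.condition f)).symm ?_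
    have hex := (exact_iff (ShortComplex.mk _ _ (cokernel.condition f))).1
      (ShortComplex.exact_cokernel f)
    exact (GroupoidSheaf.nonempty_isColimit_of_stalk
      ((sheafFunctor Λ k).map f) ((sheafFunctor Λ k).map (cokernel.π f)) _
      (fun x => stalkHom_surjective (cokernel.π f) x) fun x => stalkHom_exact hex x).some

/-- A homomorphism of stalks is the one induced by `η` if and only if it has the given values on
the elements represented at stage `p`, written with representatives at later stages. -/
theorem eq_stalkHom_iff (η : A ⟶ B) (x : InfinitePath k Λ) (g : A.Stalk x →+ B.Stalk x) :
    g = stalkHom η x ↔ ∀ (p q : Fin k → ℕ) (h : p ≤ q) (a : A.at' (x.obj p)),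
      g (A.toStalk x p a) = B.toStalk x q (B.res (x.map h) (compAt η (x.obj p) a)) := by
  simp only [toStalk_res]
  constructor
  · rintro rfl p q - a
    exact stalkHom_toStalk η x p a
  · exact fun h => stalk_hom_ext fun p a => (h p p le_rfl a).trans (stalkHom_toStalk η x p a).symm

end RightModule
end

theorem theorem3p7 {k : ℕ} {Λ : Type u} [Category.{v} Λ] [KGraph k Λ]
    (hfin : KGraph.RowFinite k Λ) (hsrc : KGraph.NoSources k Λ) :
    ∃ S : ∀ A : RightModule.{u, v, w} Λ,
        GroupoidSheafStructure (fun x : InfinitePath k Λ => A.Stalk x),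
      -- the action is `(x, n, y) · φ^y_q(b) = φ^x_p(b)` if `n = p - q` and `σ^p(x) = σ^q(y)`
      (∀ (A : RightModule.{u, v, w} Λ) {x y : InfinitePath k Λ} (γ : y ⟶ x) (p q : Fin k → ℕ)
        (_ : ∀ i, InfinitePath.lag γ i = (p i : ℤ) - (q i : ℤ))
        (h : x.shift p = y.shift q) (b : A.at' (y.obj q)),
        (S A).act γ (A.toStalk y q b) =
          A.toStalk x p (A.res (eqToHom (RightModule.obj_eq_of_shift_eq h)) b)) ∧
      ∃ (map : ∀ {A B : RightModule.{u, v, w} Λ}, (A ⟶ B) → (A.sheafOf (S A) ⟶ B.sheafOf (S B)))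
        (map_id : ∀ A : RightModule.{u, v, w} Λ, map (𝟙 A) = 𝟙 (A.sheafOf (S A)))
        (map_comp : ∀ {A B C : RightModule.{u, v, w} Λ} (η : A ⟶ B) (θ : B ⟶ C),
          map (η ≫ θ) = map η ≫ map θ),
        -- the formula for the morphism associated to `η`
        (∀ {A B : RightModule.{u, v, w} Λ} (η : A ⟶ B) (x : InfinitePath k Λ) (p : Fin k → ℕ)
          (a : A.at' (x.obj p)),
          GroupoidSheaf.stalkMap (map η) x (A.toStalk x p a) =
            B.toStalk x p (RightModule.compAt η (x.obj p) a)) ∧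
        -- on stalks, it is the direct limit of either of the two families of composites
        (∀ {A B : RightModule.{u, v, w} Λ} (η : A ⟶ B) (x : InfinitePath k Λ)
          (g : A.Stalk x →+ B.Stalk x),
          (g = GroupoidSheaf.stalkMap (map η) x ↔
            ∀ (p q : Fin k → ℕ) (h : p ≤ q) (a : A.at' (x.obj p)), g (A.toStalk x p a) =
              B.toStalk x q (RightModule.compAt η (x.obj q) (A.res (x.map h) a))) ∧
          (g = GroupoidSheaf.stalkMap (map η) x ↔
            ∀ (p q : Fin k → ℕ) (h : p ≤ q) (a : A.at' (x.obj p)), g (A.toStalk x p a) =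
              B.toStalk x q (B.res (x.map h) (RightModule.compAt η (x.obj p) a)))) ∧
        -- the resulting functor is additive and exact
        let F : RightModule.{u, v, w} Λ ⥤ GroupoidSheaf (InfinitePath k Λ) :=
          { obj := fun A => A.sheafOf (S A)
            map := fun η => map η
            map_id := map_id
            map_comp := fun η θ => map_comp η θ }
        ∃ _ : F.Additive,
          ∀ T : ShortComplex (RightModule.{u, v, w} Λ),
            (∀ v : Λ, Function.Exact (RightModule.compAt T.f v) (RightModule.compAt T.g v)) →
              (T.map F).Exact ∧
              ∀ x : InfinitePath k Λ, Function.Exact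
                (GroupoidSheaf.stalkMap (F.map T.f) x) (GroupoidSheaf.stalkMap (F.map T.g) x) := by
  refine ⟨fun A => RightModule.sheafStructure A k,
    fun A {x y} γ p q hlag h b => A.actHom_toStalk γ p q hlag h b,
    RightModule.sheafHom k, (RightModule.sheafFunctor Λ k).map_id,
    (RightModule.sheafFunctor Λ k).map_comp,
    fun η x p a => RightModule.stalkHom_toStalk η x p a, fun η x g => ⟨?_, ?_⟩, ?_⟩
  · simp only [RightModule.compAt_res]
    exact RightModule.eq_stalkHom_iff η x g
  · exact RightModule.eq_stalkHom_iff η x g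
  · intro F
    refine ⟨inferInstanceAs (RightModule.sheafFunctor Λ k).Additive, fun T hT => ⟨?_, fun x => ?_⟩⟩
    · exact ((RightModule.exact_iff T).2 hT).map (RightModule.sheafFunctor Λ k)
    · exact RightModule.stalkHom_exact hT x
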